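/- A plane binary tree is a rooted tree in which every vertex either is a leaf or has exactly two children, which are ordered (an upper and a lower child); a single vertex, being both root and leaf, is allowed. A tanglegram layout $(L,R,\sigma)$ consists of a left plane binary tree $L$, a right plane binary tree $R$ and a perfect matching $\sigma$ between the leaves of $L$ and the leaves of $R$. Two matching edges $x\,\sigma(x)$ and $y\,\sigma(y)$ cross if $x$ is above $y$ in the plane order of the leaves of $L$ while $\sigma(x)$ is below $\sigma(y)$ in that of $R$, or vice versa. A switch at an internal vertex $v$ of $L$ or $R$ interchanges the upper and the lower subtree at $v$, the matching edges moving along with the leaves. A tanglegram is an equivalence class of layouts, two layouts being equivalent if a finite sequence of switches moves one into the other; it is planar if it has a layout in which no two matching edges cross, and non-planar otherwise. Let $T$ be a non-planar tanglegram represented by a layout $(L,R,\sigma)$, and let $T^*$ be the graph that consists of the two trees $L$ and $R$, the edges of the matching $\sigma$, and one additional edge joining the root of $L$ to the root of $R$. Then $T^*$ contains a subdivision of $K_{3,3}$ such that three of its six branch vertices (the original vertices of the $K_{3,3}$) lie in $L$ and the other three lie in $R$. -/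

import Mathlib

/-- Plane binary trees: a tree is a single vertex (both root and leaf), or a root together with
an ordered pair of subtrees, the upper one and the lower one. -/
inductive PlaneBinaryTree : Type
  | leaf : PlaneBinaryTree
  | node (upper lower : PlaneBinaryTree) : PlaneBinaryTree

namespace PlaneBinaryTree

/-- The vertices (internal vertices and leaves) of a plane binary tree. -/
inductive Vertex : PlaneBinaryTree → Type
  | root {t : PlaneBinaryTree} : Vertex t
  | up {u d : PlaneBinaryTree} (v : Vertex u) : Vertex (node u d)
  | down {u d : PlaneBinaryTree} (v : Vertex d) : Vertex (node u d)

/-- `IsChild p c`: the vertex `c` is one of the two children of the vertex `p`. -/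
inductive IsChild : {t : PlaneBinaryTree} → Vertex t → Vertex t → Prop
  | upper {u d : PlaneBinaryTree} :
      IsChild (Vertex.root : Vertex (node u d)) (Vertex.up Vertex.root)
  | lower {u d : PlaneBinaryTree} :
      IsChild (Vertex.root : Vertex (node u d)) (Vertex.down Vertex.root)
  | up {u d : PlaneBinaryTree} {p c : Vertex u} (h : IsChild p c) :
      IsChild (Vertex.up p : Vertex (node u d)) (Vertex.up c)
  | down {u d : PlaneBinaryTree} {p c : Vertex d} (h : IsChild p c) :
      IsChild (Vertex.down p : Vertex (node u d)) (Vertex.down c)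

/-- The leaves of a plane binary tree. -/
inductive Leaf : PlaneBinaryTree → Type
  | here : Leaf leaf
  | up {u d : PlaneBinaryTree} (x : Leaf u) : Leaf (node u d)
  | down {u d : PlaneBinaryTree} (x : Leaf d) : Leaf (node u d)

/-- A leaf, as a vertex of the tree. -/
def Leaf.toVertex : {t : PlaneBinaryTree} → Leaf t → Vertex t
  | _, Leaf.here => Vertex.root
  | _, Leaf.up x => Vertex.up x.toVertex
  | _, Leaf.down x => Vertex.down x.toVertex

/-- `Above x y`: in the plane drawing of the tree with all its leaves on a vertical line, the
leaf `x` lies strictly above the leaf `y`. -/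
inductive Above : {t : PlaneBinaryTree} → Leaf t → Leaf t → Prop
  | split {u d : PlaneBinaryTree} (x : Leaf u) (y : Leaf d) :
      Above (Leaf.up x : Leaf (node u d)) (Leaf.down y)
  | up {u d : PlaneBinaryTree} {x y : Leaf u} (h : Above x y) :
      Above (Leaf.up x : Leaf (node u d)) (Leaf.up y)
  | down {u d : PlaneBinaryTree} {x y : Leaf d} (h : Above x y) :
      Above (Leaf.down x : Leaf (node u d)) (Leaf.down y)

/-- The elements of `Switch s t` are the internal vertices of `s` at which interchanging the
upper and the lower subtree turns `s` into `t`. -/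
inductive Switch : PlaneBinaryTree → PlaneBinaryTree → Type
  | here (u d : PlaneBinaryTree) : Switch (node u d) (node d u)
  | up {u u' : PlaneBinaryTree} (s : Switch u u') (d : PlaneBinaryTree) :
      Switch (node u d) (node u' d)
  | down (u : PlaneBinaryTree) {d d' : PlaneBinaryTree} (s : Switch d d') :
      Switch (node u d) (node u d')

namespace Switch

/-- Where a switch moves a leaf. -/
def move : {s t : PlaneBinaryTree} → Switch s t → Leaf s → Leaf t
  | _, _, here _ _, Leaf.up x => Leaf.down x
  | _, _, here _ _, Leaf.down x => Leaf.up x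
  | _, _, up w _, Leaf.up x => Leaf.up (w.move x)
  | _, _, up _ _, Leaf.down x => Leaf.down x
  | _, _, down _ _, Leaf.up x => Leaf.up x
  | _, _, down _ w, Leaf.down x => Leaf.down (w.move x)

/-- The switch at the same vertex, which undoes the given one. -/
def symm : {s t : PlaneBinaryTree} → Switch s t → Switch t s
  | _, _, here u d => here d u
  | _, _, up w d => up w.symm d
  | _, _, down u w => down u w.symm

theorem symm_symm {s t : PlaneBinaryTree} (w : Switch s t) : w.symm.symm = w := by
  induction w with
  | here u d => rfl
  | up w d ih => simp [symm, ih]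
  | down u w ih => simp [symm, ih]

theorem move_symm_move {s t : PlaneBinaryTree} (w : Switch s t) (x : Leaf s) :
    w.symm.move (w.move x) = x := by
  induction w with
  | here u d => cases x <;> rfl
  | up w d ih => cases x <;> simp [symm, move, ih]
  | down u w ih => cases x <;> simp [symm, move, ih]

/-- The bijection between the leaves before and after a switch. -/
def leafEquiv {s t : PlaneBinaryTree} (w : Switch s t) : Leaf s ≃ Leaf t where
  toFun := w.move
  invFun := w.symm.move
  left_inv := w.move_symm_move
  right_inv x := by simpa only [symm_symm] using w.symm.move_symm_move x

theorem leafEquiv_symm {s t : PlaneBinaryTree} (w : Switch s t) :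
    w.symm.leafEquiv = w.leafEquiv.symm :=
  Equiv.ext fun _ => rfl

end Switch

end PlaneBinaryTree

open PlaneBinaryTree in
/-- A tanglegram layout `(L, R, σ)`: a left and a right plane binary tree and a perfect matching
between their leaves. -/
structure TanglegramLayout : Type where
  L : PlaneBinaryTree
  R : PlaneBinaryTree
  σ : Leaf L ≃ Leaf R

namespace TanglegramLayout

open PlaneBinaryTree

/-- One switch, at an internal vertex of the left or of the right tree; the matching edges move
along with the leaves. -/
inductive SwitchStep : TanglegramLayout → TanglegramLayout → Prop
  | left {L L' R : PlaneBinaryTree} (σ : Leaf L ≃ Leaf R) (w : Switch L L') :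
      SwitchStep ⟨L, R, σ⟩ ⟨L', R, w.leafEquiv.symm.trans σ⟩
  | right {L R R' : PlaneBinaryTree} (σ : Leaf L ≃ Leaf R) (w : Switch R R') :
      SwitchStep ⟨L, R, σ⟩ ⟨L, R', σ.trans w.leafEquiv⟩

theorem SwitchStep.symm {Λ Λ' : TanglegramLayout} (h : SwitchStep Λ Λ') : SwitchStep Λ' Λ := by
  cases h with
  | left σ w =>
    have h := SwitchStep.left (w.leafEquiv.symm.trans σ) w.symm
    rwa [Switch.leafEquiv_symm, Equiv.symm_symm, ← Equiv.trans_assoc, Equiv.self_trans_symm,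
      Equiv.refl_trans] at h
  | right σ w =>
    have h := SwitchStep.right (σ.trans w.leafEquiv) w.symm
    rwa [Switch.leafEquiv_symm, Equiv.trans_assoc, Equiv.self_trans_symm,
      Equiv.trans_refl] at h

/-- Two layouts are equivalent if a finite sequence of switches moves one into the other. -/
instance switchSetoid : Setoid TanglegramLayout where
  r := Relation.ReflTransGen SwitchStep
  iseqv :=
    { refl := fun _ => Relation.ReflTransGen.refl
      symm := by
        intro Λ Λ' h
        induction h with
        | refl => exact Relation.ReflTransGen.refl
        | tail _ h ih => exact Relation.ReflTransGen.head h.symm ih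
      trans := fun h h' => Relation.ReflTransGen.trans h h' }

/-- The matching edges at the leaves `x` and `y` of the left tree cross (with `x` above `y`). -/
def Cross (Λ : TanglegramLayout) (x y : Leaf Λ.L) : Prop :=
  Above x y ∧ Above (Λ.σ y) (Λ.σ x)

/-- The edges of the two trees and the matching edges of a layout. -/
inductive Edge (Λ : TanglegramLayout) : Vertex Λ.L ⊕ Vertex Λ.R → Vertex Λ.L ⊕ Vertex Λ.R → Prop
  | left {p c : Vertex Λ.L} (h : IsChild p c) : Edge Λ (Sum.inl p) (Sum.inl c)
  | right {p c : Vertex Λ.R} (h : IsChild p c) : Edge Λ (Sum.inr p) (Sum.inr c)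
  | matching (x : Leaf Λ.L) : Edge Λ (Sum.inl x.toVertex) (Sum.inr (Λ.σ x).toVertex)

/-- The underlying graph: the two binary trees and the matching edges. -/
def graph (Λ : TanglegramLayout) : SimpleGraph (Vertex Λ.L ⊕ Vertex Λ.R) :=
  SimpleGraph.fromRel Λ.Edge

/-- The augmented graph `T*`: the underlying graph and the edge joining the two roots. -/
def augmentedGraph (Λ : TanglegramLayout) : SimpleGraph (Vertex Λ.L ⊕ Vertex Λ.R) :=
  Λ.graph ⊔ SimpleGraph.edge (Sum.inl Vertex.root) (Sum.inr Vertex.root)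

end TanglegramLayout

/-- A tanglegram is an equivalence class of tanglegram layouts under switches. -/
def Tanglegram : Type := Quotient TanglegramLayout.switchSetoid

namespace Tanglegram

/-- `T.IsRepresentedBy Λ`: the layout `Λ` belongs to the class `T`. -/
def IsRepresentedBy (T : Tanglegram) (Λ : TanglegramLayout) : Prop :=
  Quotient.mk TanglegramLayout.switchSetoid Λ = T

/-- A tanglegram is planar if it has a layout without crossing matching edges. -/
def IsPlanar (T : Tanglegram) : Prop :=
  ∃ Λ : TanglegramLayout, T.IsRepresentedBy Λ ∧ ∀ x y, ¬ Λ.Cross x y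

end Tanglegram

/-- A subdivision of the graph `H` contained in the graph `G`: distinct branch vertices for the
vertices of `H`, and for every edge of `H` a path in `G` between the branch vertices of its ends,
such that these paths have no inner vertex among the branch vertices and no two of them share an
inner vertex. -/
structure ContainedSubdivision {W V : Type*} (H : SimpleGraph W) (G : SimpleGraph V) where
  branch : W → V
  branch_injective : Function.Injective branch
  path : ∀ {a b : W}, H.Adj a b → G.Walk (branch a) (branch b)
  isPath : ∀ {a b : W} (h : H.Adj a b), (path h).IsPath
  /-- One path per edge: the two orientations of an edge give the same path. -/
  path_symm : ∀ {a b : W} (h : H.Adj a b), path h.symm = (path h).reverse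
  /-- A path contains no branch vertices but its two ends. -/
  branch_mem : ∀ {a b : W} (h : H.Adj a b) (c : W), branch c ∈ (path h).support → c = a ∨ c = b
  /-- The paths of two different edges meet in branch vertices only. -/
  disjoint : ∀ {a b c d : W} (h : H.Adj a b) (h' : H.Adj c d), s(a, b) ≠ s(c, d) →
    ∀ v, v ∈ (path h).support → v ∈ (path h').support → v ∈ Set.range branch

/-! Two matching edges have left ends that part at a vertex `p` of `L` and right ends that part at a
vertex `q` of `R`. Whether they cross depends only on which child is drawn above at `p` and at `q`.
A crossing-free layout thus amounts to bits `ε p`, `δ q` solving equations `ε p + δ q = s` over the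
field with two elements, one for each pair of leaves; `Parity` records them.

Two contradictory equations at the same `(p, q)` give a `BalancedConflict`. If there are none, link
each internal vertex to the vertex of the other tree where its cluster splits. Links lead to
clusters at least as large, so, with ties broken, their equations can be solved recursively
(`exists_potential`). Any other equation closes a four-cycle with two links and an equation between
larger clusters; by `parity_four_cycle` such a cycle is consistent unless there is a
`CaterpillarConflict`. Hence a non-planar tanglegram contains one of two conflicts on four leaves
(`exists_conflict`).

In `T*` the root edge acts as a fifth matching edge. A binary tree on four leaves, with its root as
a fifth end, is a subdivision of the cubic tree with five ends, which is unique: a path of three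
branch vertices with 2, 1, 2 ends attached. Both conflicts become the same picture, two such
caterpillars joined so that one end of each outer pair is exchanged, and this is a subdivided
`K₃,₃`. -/

/-! ### Parity equations for two hierarchies on the same leaves -/

/-- A family of bipartitioned clusters on `X` that behaves like the internal vertices of a binary
tree with leaf set `X`: `side p i` is the set of leaves below the child `i` of the vertex `p`. -/
structure BinaryHierarchy (X N : Type*) where
  side : N → Bool → Set X
  side_unique : ∀ {p i j x}, x ∈ side p i → x ∈ side p j → i = j
  nested : ∀ {p q i j x}, x ∈ side p i → x ∈ side q j →
    p = q ∨ (∀ k, side p k ⊆ side q j) ∨ ∀ k, side q k ⊆ side p i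
  exists_split : ∀ S : Set X, S.Nontrivial →
    ∃ p, (∀ x ∈ S, ∃ i, x ∈ side p i) ∧ ∀ i, ∃ x ∈ S, x ∈ side p i

/-- Every map that increases a bounded rank admits a potential with prescribed increments. -/
theorem exists_potential {N : Type*} (m : N → ℕ) (b : ℕ) (hb : ∀ n, m n ≤ b) (par : N → N)
    (sg : N → Bool) :
    ∃ e : N → Bool, ∀ n, m n < m (par n) → e n = xor (sg n) (e (par n)) := by
  classical
  -- As `m` is bounded by `b`, each rise of `m` lowers `b - m`, so the recursion along `par` stops.
  -- The value `false` where the rank does not rise is arbitrary.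
  have wf : WellFounded (fun x y : N => b - m x < b - m y) := (measure fun n => b - m n).wf
  have key : ∀ n, m n < m (par n) → b - m (par n) < b - m n := fun n h => by
    have := hb (par n)
    omega
  refine ⟨wf.fix fun n rec =>
    if h : m n < m (par n) then xor (sg n) (rec (par n) (key n h)) else false, fun n h => ?_⟩
  rw [wf.fix_eq, dif_pos h]

namespace BinaryHierarchy

variable {X N M : Type*} (H : BinaryHierarchy X N) (K : BinaryHierarchy X M)

/-- The leaves below `p`. -/
def cluster (p : N) : Set X := {x | ∃ i, x ∈ H.side p i}

/-- Some pair of leaves is separated both by `p` and by `q`, and `s` tells whether the two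
separations are in opposite directions. -/
def Parity (p : N) (q : M) (s : Bool) : Prop :=
  ∃ i j u v, u ∈ H.side p i ∧ v ∈ H.side p !i ∧ u ∈ K.side q j ∧ v ∈ K.side q !j ∧ s = xor i j

/-- Four leaves that are paired in two different ways by the balanced trees they span. -/
def BalancedConflict : Prop :=
  ∃ p q i j u u' v v', u ∈ H.side p i ∧ u' ∈ H.side p i ∧ v ∈ H.side p !i ∧ v' ∈ H.side p !i ∧
    u ∈ K.side q j ∧ v' ∈ K.side q j ∧ v ∈ K.side q !j ∧ u' ∈ K.side q !j

/-- Four leaves spanning conflicting caterpillars `(a, (w, (b, z)))` and `(b, (w, (a, z)))`. -/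
def CaterpillarConflict : Prop :=
  ∃ p₀ p q₀ q i₀ i j₀ j a b w z,
    (∀ k, H.side p k ⊆ H.side p₀ i₀) ∧ a ∈ H.side p₀ !i₀ ∧ b ∈ H.side p i ∧ z ∈ H.side p i ∧
    w ∈ H.side p !i ∧
    (∀ k, K.side q k ⊆ K.side q₀ j₀) ∧ b ∈ K.side q₀ !j₀ ∧ a ∈ K.side q j ∧ z ∈ K.side q j ∧
    w ∈ K.side q !j

variable {H K}

theorem Parity.symm {p : N} {q : M} {s : Bool} (h : H.Parity K p q s) : K.Parity H q p s := by
  obtain ⟨i, j, u, v, h1, h2, h3, h4, rfl⟩ := h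
  exact ⟨j, i, u, v, h3, h4, h1, h2, Bool.xor_comm i j⟩

theorem Parity.exists_left {p : N} {q : M} {s : Bool} (h : H.Parity K p q s) (k : Bool) :
    ∃ x ∈ H.side p k, x ∈ K.cluster q := by
  obtain ⟨i, j, u, v, h1, h2, h3, h4, -⟩ := h
  by_cases hk : k = i
  · exact ⟨u, hk ▸ h1, _, h3⟩
  · have : k = !i := by cases k <;> cases i <;> simp_all
    exact ⟨v, this ▸ h2, _, h4⟩

/-- Rename the second pair so that its first leaf lies on the same side of `p` as that of the first
pair. Different parities then put these two leaves on opposite sides of `q`, which is a balanced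
conflict. -/
theorem Parity.unique (hB : ¬ H.BalancedConflict K) {p : N} {q : M} {s s' : Bool}
    (h : H.Parity K p q s) (h' : H.Parity K p q s') : s = s' := by
  obtain ⟨i, j, u, v, h1, h2, h3, h4, rfl⟩ := h
  obtain ⟨i', j', u', v', h1', h2', h3', h4', rfl⟩ := h'
  by_contra hne
  by_cases hi : i' = i
  · subst hi
    have : j' = !j := by cases i' <;> cases j <;> cases j' <;> simp_all
    subst this
    rw [Bool.not_not] at h4'
    exact hB ⟨p, q, i', j, u, u', v, v', h1, h1', h2, h2', h3, h4', h4, h3'⟩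
  · have hi : i' = !i := by cases i' <;> cases i <;> simp_all
    subst hi
    have : j' = j := by cases i <;> cases j <;> cases j' <;> simp_all
    subst this
    rw [Bool.not_not] at h2'
    exact hB ⟨p, q, i, j', u, v', v, u', h1, h2', h2, h1', h3, h3', h4, h4'⟩

/-- Take one leaf from each side of `p` within the cluster of `q`. If `q` does not separate them, a
leaf from the other side of `q` forms a pair with whichever of the two `p` separates from it. -/
theorem exists_parity {p : N} {q : M} (hp : ∀ i, ∃ x ∈ H.side p i, x ∈ K.cluster q)
    (hq : ∀ j, ∃ x ∈ K.side q j, x ∈ H.cluster p) : ∃ s, H.Parity K p q s := by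
  obtain ⟨x, hx, j, hxj⟩ := hp false
  obtain ⟨y, hy, j', hyj⟩ := hp true
  by_cases hj : j' = j
  · subst hj
    obtain ⟨z, hz, k, hzk⟩ := hq (!j')
    cases k
    · exact ⟨_, true, j', y, z, hy, hzk, hyj, hz, rfl⟩
    · exact ⟨_, false, j', x, z, hx, hzk, hxj, hz, rfl⟩
  · have hj : j' = !j := by cases j <;> cases j' <;> simp_all
    subst hj
    exact ⟨_, false, j, x, y, hx, hy, hxj, hyj, rfl⟩

theorem exists_parity_cluster_subset {p : N} (hp : ∀ i, (H.side p i).Nonempty) :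
    ∃ q s, H.Parity K p q s ∧ H.cluster p ⊆ K.cluster q := by
  obtain ⟨x, hx⟩ := hp false
  obtain ⟨y, hy⟩ := hp true
  have hne : x ≠ y := by
    rintro rfl
    simpa using H.side_unique hx hy
  obtain ⟨q, hq, hq'⟩ := K.exists_split (H.cluster p) ⟨x, ⟨_, hx⟩, y, ⟨_, hy⟩, hne⟩
  obtain ⟨s, hs⟩ := exists_parity (H := H) (K := K) (p := p) (q := q)
    (fun i => (hp i).imp fun z hz => ⟨hz, hq z ⟨i, hz⟩⟩)
    (fun j => (hq' j).imp fun z hz => ⟨hz.2, hz.1⟩)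
  exact ⟨q, s, hs, hq⟩

/-- Both sides of `q` meet the cluster of `p`, hence that of `q₀`; so `q₀` cannot lie inside a
single side of `q`. -/
theorem Parity.nested {p : N} {q q₀ : M} {s : Bool} (h : H.Parity K p q s)
    (hs : H.cluster p ⊆ K.cluster q₀) : q = q₀ ∨ ∃ j, ∀ k, K.side q k ⊆ K.side q₀ j := by
  obtain ⟨x, hx, i, hxi⟩ := h.symm.exists_left false
  obtain ⟨j, hj⟩ := hs ⟨i, hxi⟩
  rcases K.nested hx hj with h1 | h1 | h1
  · exact Or.inl h1
  · exact Or.inr ⟨j, h1⟩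
  · obtain ⟨y, hy, i', hyi⟩ := h.symm.exists_left true
    obtain ⟨k, hk⟩ := hs ⟨i', hyi⟩
    simpa using K.side_unique hy (h1 k hk)

/-- Choose `a` in the cluster of `q` but on the side of `p₀` away from `p`, and `b` in the cluster
of `p` but on the side of `q₀` away from `q`. Their sides `j` of `q` and `i` of `p` determine all
four parities. A wrong `s` would yield `z` on sides `i`, `j` and `w` on the opposite sides, hence a
caterpillar conflict. -/
theorem parity_four_cycle (hB : ¬ H.BalancedConflict K) (hC : ¬ H.CaterpillarConflict K)
    {p p₀ : N} {q q₀ : M} {i₀ j₀ s s₁ s₂ s₃ : Bool} (hp : ∀ k, H.side p k ⊆ H.side p₀ i₀)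
    (hq : ∀ k, K.side q k ⊆ K.side q₀ j₀) (h : H.Parity K p q s) (h₁ : H.Parity K p q₀ s₁)
    (h₂ : H.Parity K p₀ q s₂) (h₃ : H.Parity K p₀ q₀ s₃) : s = xor s₁ (xor s₂ s₃) := by
  obtain ⟨a, ha, j, haj⟩ := h₂.exists_left !i₀
  obtain ⟨b, hb, i, hbi⟩ := h₁.symm.exists_left !j₀
  obtain ⟨w₁, hw₁, k₁, hk₁⟩ := h.symm.exists_left !j
  obtain ⟨w₂, hw₂, k₂, hk₂⟩ := h.exists_left !i
  have e₁ : s₁ = xor i !j₀ :=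
    h₁.unique hB ⟨i, !j₀, b, w₂, hbi, hw₂, hb, by simpa using hq _ hk₂, rfl⟩
  have e₂ : s₂ = xor (!i₀) j :=
    h₂.unique hB ⟨!i₀, j, a, w₁, ha, by simpa using hp _ hk₁, haj, hw₁, rfl⟩
  have e₃ : s₃ = xor (!i₀) j₀ :=
    h₃.unique hB ⟨!i₀, j₀, a, b, ha, by simpa using hp _ hbi, hq _ haj, hb, rfl⟩
  have e : s = xor i !j := by
    obtain ⟨i', j', u, v, hu, hv, hu', hv', rfl⟩ := h
    by_contra hne
    by_cases hi : i' = i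
    · subst hi
      have : j' = j := by cases i' <;> cases j <;> cases j' <;> simp_all
      subst this
      exact hC ⟨p₀, p, q₀, q, i₀, i', j₀, j', a, b, v, u, hp, ha, hbi, hu, hv, hq, hb, haj, hu',
        hv'⟩
    · have hi : i' = !i := by cases i' <;> cases i <;> simp_all
      subst hi
      have : j' = !j := by cases i <;> cases j <;> cases j' <;> simp_all
      subst this
      rw [Bool.not_not] at hv hv'
      exact hC ⟨p₀, p, q₀, q, i₀, i, j₀, j, a, b, u, v, hp, ha, hbi, hv, hu, hq, hb, haj, hv',
        hu'⟩
  subst e e₁ e₂ e₃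
  cases i <;> cases j <;> cases i₀ <;> cases j₀ <;> rfl

theorem ncard_cluster_lt [Finite X] {p p₀ : N} {i₀ : Bool}
    (hp : ∀ k, H.side p k ⊆ H.side p₀ i₀) (h : (H.side p₀ !i₀).Nonempty) :
    (H.cluster p).ncard < (H.cluster p₀).ncard := by
  refine Set.ncard_lt_ncard ⟨fun x ⟨k, hk⟩ => ⟨i₀, hp k hk⟩, fun hsub => ?_⟩ (Set.toFinite _)
  obtain ⟨x, hx⟩ := h
  obtain ⟨k, hk⟩ := hsub ⟨_, hx⟩
  simpa using H.side_unique hx (hp k hk)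

/-- Two binary hierarchies without a conflict can be oriented consistently. -/
theorem exists_orientation [Finite X] (hB : ¬ H.BalancedConflict K)
    (hC : ¬ H.CaterpillarConflict K) :
    ∃ (ε : N → Bool) (δ : M → Bool), ∀ p q s, H.Parity K p q s → xor (ε p) (δ q) = s := by
  classical
  -- The link of `p` goes to the vertex where its cluster splits in the other hierarchy. A vertex
  -- without two nonempty sides is linked to itself, where the rank does not rise and nothing is
  -- imposed.
  have parL : ∀ p : N, ∃ (n : N ⊕ M) (s : Bool), (∀ i, (H.side p i).Nonempty) →
      ∃ q, n = Sum.inr q ∧ H.Parity K p q s ∧ H.cluster p ⊆ K.cluster q := fun p => by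
    by_cases hp : ∀ i, (H.side p i).Nonempty
    · obtain ⟨q, s, h⟩ := exists_parity_cluster_subset (K := K) hp
      exact ⟨Sum.inr q, s, fun _ => ⟨q, rfl, h⟩⟩
    · exact ⟨Sum.inl p, false, fun h => absurd h hp⟩
  have parR : ∀ q : M, ∃ (n : N ⊕ M) (s : Bool), (∀ i, (K.side q i).Nonempty) →
      ∃ p, n = Sum.inl p ∧ H.Parity K p q s ∧ K.cluster q ⊆ H.cluster p := fun q => by
    by_cases hq : ∀ i, (K.side q i).Nonempty
    · obtain ⟨p, s, h, h'⟩ := exists_parity_cluster_subset (K := H) hq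
      exact ⟨Sum.inl p, s, fun _ => ⟨p, rfl, h.symm, h'⟩⟩
    · exact ⟨Sum.inr q, false, fun h => absurd h hq⟩
  choose fL sL hL using parL
  choose fR sR hR using parR
  -- Doubling the sizes and adding one on the left breaks ties: links from right to left always
  -- raise the rank, links from left to right only when the cluster grows strictly.
  obtain ⟨e, he⟩ := exists_potential
    (Sum.elim (fun p => 2 * (H.cluster p).ncard + 1) fun q => 2 * (K.cluster q).ncard)
    (2 * Nat.card X + 1)
    (by
      have hc (S : Set X) : S.ncard ≤ Nat.card X := Set.ncard_le_card S
      rintro (p | q)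
      · simpa using hc (H.cluster p)
      · have := hc (K.cluster q)
        simp only [Sum.elim_inr]
        omega)
    (Sum.elim fL fR) (Sum.elim sL sR)
  have up : ∀ q, (∀ i, (K.side q i).Nonempty) → ∃ p s, H.Parity K p q s ∧
      K.cluster q ⊆ H.cluster p ∧ xor (e (Sum.inl p)) (e (Sum.inr q)) = s := fun q hq => by
    obtain ⟨p, hp, hs, hsub⟩ := hR q hq
    have hcard := Set.ncard_le_ncard hsub (Set.toFinite _)
    have := he (Sum.inr q) (by simp only [Sum.elim_inr, hp, Sum.elim_inl]; omega)
    refine ⟨p, _, hs, hsub, ?_⟩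
    simp only [Sum.elim_inr, hp] at this
    rw [this]
    cases e (Sum.inl p) <;> cases sR q <;> rfl
  have down : ∀ p, (∀ i, (H.side p i).Nonempty) → ∃ q s, H.Parity K p q s ∧
      H.cluster p ⊆ K.cluster q ∧ xor (e (Sum.inl p)) (e (Sum.inr q)) = s := fun p hp => by
    obtain ⟨q, hq, hs, hsub⟩ := hL p hp
    rcases (Set.ncard_le_ncard hsub (Set.toFinite _)).lt_or_eq with hlt | heq
    · have := he (Sum.inl p) (by simp only [Sum.elim_inr, hq, Sum.elim_inl]; omega)
      refine ⟨q, _, hs, hsub, ?_⟩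
      simp only [Sum.elim_inl, hq] at this
      rw [this]
      cases e (Sum.inr q) <;> cases sL p <;> rfl
    -- With equal clusters the link from `p` is not covered by the potential, but the link from `q`
    -- is, and it leads back to `p`: otherwise `p` would lie within one side of `p'`, whose other
    -- side meets the same cluster.
    · have hpq := Set.eq_of_subset_of_ncard_le hsub heq.ge (Set.toFinite _)
      obtain ⟨p', s', hs', hsub', hp'⟩ := up q fun j => (hs.symm.exists_left j).imp fun _ h => h.1
      suffices p' = p from ⟨q, s', this ▸ hs', hsub, this ▸ hp'⟩
      obtain rfl | ⟨j, hj⟩ := hs.symm.nested hsub'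
      · rfl
      · obtain ⟨x, hx, hx'⟩ := hs'.exists_left !j
        obtain ⟨k, hk⟩ := hpq ▸ hx'
        simpa using H.side_unique hx (hj k hk)
  refine ⟨fun p => e (Sum.inl p), fun q => e (Sum.inr q), ?_⟩
  -- Induction from large clusters to small ones; the measure is the total number of leaves missing
  -- from the two clusters.
  suffices ∀ n p q s, 2 * Nat.card X - (H.cluster p).ncard - (K.cluster q).ncard ≤ n →
      H.Parity K p q s → xor (e (Sum.inl p)) (e (Sum.inr q)) = s from
    fun p q s => this _ p q s le_rfl
  intro n
  induction n using Nat.strong_induction_on with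
  | _ n ih =>
  intro p q s hn h
  obtain ⟨q₀, s₁, h₁, hsub₁, e₁⟩ := down p fun i => (h.exists_left i).imp fun _ h => h.1
  obtain ⟨p₀, s₂, h₂, hsub₂, e₂⟩ := up q fun i => (h.symm.exists_left i).imp fun _ h => h.1
  obtain rfl | ⟨j₀, hj₀⟩ := h.nested hsub₁
  · rw [e₁, h.unique hB h₁]
  obtain rfl | ⟨i₀, hi₀⟩ := h.symm.nested hsub₂
  · rw [e₂, h.unique hB h₂]
  -- Neither equation is a link, so both linked vertices are strictly larger and close a four-cycle
  -- with `p` and `q`.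
  obtain ⟨s₃, h₃⟩ := exists_parity (H := H) (K := K) (p := p₀) (q := q₀)
    (fun i => (h₂.exists_left i).imp fun x hx => ⟨hx.1, hx.2.elim fun k hk => ⟨j₀, hj₀ k hk⟩⟩)
    (fun j => (h₁.symm.exists_left j).imp fun x hx =>
      ⟨hx.1, hx.2.elim fun k hk => ⟨i₀, hi₀ k hk⟩⟩)
  have l₁ := ncard_cluster_lt hi₀ ((h₂.exists_left _).imp fun _ h => h.1)
  have l₂ := ncard_cluster_lt hj₀ ((h₁.symm.exists_left _).imp fun _ h => h.1)
  have c₁ := Set.ncard_le_card (H.cluster p₀)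
  have c₂ := Set.ncard_le_card (K.cluster q₀)
  have e₃ := ih _ (by omega) p₀ q₀ s₃ le_rfl h₃
  rw [parity_four_cycle hB hC hi₀ hj₀ h h₁ h₂ h₃, ← e₁, ← e₂, ← e₃]
  cases e (Sum.inl p) <;> cases e (Sum.inr q) <;> cases e (Sum.inl p₀) <;>
    cases e (Sum.inr q₀) <;> rfl

end BinaryHierarchy

/-! ### Plane trees as hierarchies, and what switches achieve -/

namespace PlaneBinaryTree

instance (t : PlaneBinaryTree) : Finite (Leaf t) := by
  induction t with
  | leaf =>
    have : Subsingleton (Leaf leaf) := ⟨fun x y => by cases x; cases y; rfl⟩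
    infer_instance
  | node u d ihu ihd =>
    refine Finite.of_surjective (Sum.elim Leaf.up Leaf.down : Leaf u ⊕ Leaf d → _) fun x => ?_
    cases x with
    | up x => exact ⟨Sum.inl x, rfl⟩
    | down x => exact ⟨Sum.inr x, rfl⟩

/-- `BelowChild p i x`: the leaf `x` lies below the upper (`i = false`) or the lower (`i = true`)
child of the vertex `p`. -/
inductive BelowChild : {t : PlaneBinaryTree} → Vertex t → Bool → Leaf t → Prop
  | upper {u d : PlaneBinaryTree} (x : Leaf u) :
      BelowChild (Vertex.root : Vertex (node u d)) false (Leaf.up x)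
  | lower {u d : PlaneBinaryTree} (x : Leaf d) :
      BelowChild (Vertex.root : Vertex (node u d)) true (Leaf.down x)
  | up {u d : PlaneBinaryTree} {p : Vertex u} {i : Bool} {x : Leaf u} (h : BelowChild p i x) :
      BelowChild (Vertex.up p : Vertex (node u d)) i (Leaf.up x)
  | down {u d : PlaneBinaryTree} {p : Vertex d} {i : Bool} {x : Leaf d} (h : BelowChild p i x) :
      BelowChild (Vertex.down p : Vertex (node u d)) i (Leaf.down x)

theorem BelowChild.unique {t : PlaneBinaryTree} {p : Vertex t} {i j : Bool} {x : Leaf t}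
    (h : BelowChild p i x) (h' : BelowChild p j x) : i = j := by
  induction h with
  | upper x => cases h'; rfl
  | lower x => cases h'; rfl
  | up h ih => cases h' with | up h' => exact ih h'
  | down h ih => cases h' with | down h' => exact ih h'

theorem BelowChild.nested {t : PlaneBinaryTree} {p q : Vertex t} {i j : Bool} {x : Leaf t}
    (h : BelowChild p i x) (h' : BelowChild q j x) :
    p = q ∨ (∀ k y, BelowChild p k y → BelowChild q j y) ∨
      ∀ k y, BelowChild q k y → BelowChild p i y := by
  induction h with
  | upper x =>
    cases h' with
    | upper => exact Or.inl rfl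
    | up h' =>
      refine Or.inr (Or.inr fun k y hy => ?_)
      cases hy
      constructor
  | lower x =>
    cases h' with
    | lower => exact Or.inl rfl
    | down h' =>
      refine Or.inr (Or.inr fun k y hy => ?_)
      cases hy
      constructor
  | up h ih =>
    cases h' with
    | upper =>
      refine Or.inr (Or.inl fun k y hy => ?_)
      cases hy
      constructor
    | up h' =>
      refine (ih h').imp (congrArg _) (Or.imp (fun H k y hy => ?_) fun H k y hy => ?_) <;>
      · cases hy with | up hy => exact .up (H _ _ hy)
  | down h ih =>
    cases h' with
    | lower =>
      refine Or.inr (Or.inl fun k y hy => ?_)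
      cases hy
      constructor
    | down h' =>
      refine (ih h').imp (congrArg _) (Or.imp (fun H k y hy => ?_) fun H k y hy => ?_) <;>
      · cases hy with | down hy => exact .down (H _ _ hy)

theorem exists_belowChild_split {t : PlaneBinaryTree} (S : Set (Leaf t)) (hS : S.Nontrivial) :
    ∃ p, (∀ x ∈ S, ∃ i, BelowChild p i x) ∧ ∀ i, ∃ x ∈ S, BelowChild p i x := by
  induction t with
  | leaf =>
    obtain ⟨x, -, y, -, h⟩ := hS
    cases x
    cases y
    exact absurd rfl h
  | node u d ihu ihd =>
    by_cases hu : ∃ x, Leaf.up x ∈ S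
    · by_cases hd : ∃ x, Leaf.down x ∈ S
      · obtain ⟨x, hx⟩ := hu
        obtain ⟨y, hy⟩ := hd
        refine ⟨Vertex.root, fun z _ => ?_, fun i => ?_⟩
        · cases z with
          | up z => exact ⟨_, .upper z⟩
          | down z => exact ⟨_, .lower z⟩
        · cases i
          · exact ⟨_, hx, .upper x⟩
          · exact ⟨_, hy, .lower y⟩
      · have hup : ∀ x ∈ S, ∃ z, x = Leaf.up z := fun x hx => by
          cases x with
          | up z => exact ⟨z, rfl⟩
          | down z => exact absurd ⟨z, hx⟩ hd
        obtain ⟨x, hx, y, hy, hne⟩ := hS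
        obtain ⟨x, rfl⟩ := hup x hx
        obtain ⟨y, rfl⟩ := hup y hy
        obtain ⟨p, h₁, h₂⟩ := ihu {z | Leaf.up z ∈ S} ⟨x, hx, y, hy, fun h => hne (h ▸ rfl)⟩
        refine ⟨Vertex.up p, fun z hz => ?_, fun i => ?_⟩
        · obtain ⟨z, rfl⟩ := hup z hz
          exact (h₁ z hz).imp fun _ h => .up h
        · obtain ⟨z, hz, h⟩ := h₂ i
          exact ⟨_, hz, .up h⟩
    · have hdown : ∀ x ∈ S, ∃ z, x = Leaf.down z := fun x hx => by
        cases x with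
        | down z => exact ⟨z, rfl⟩
        | up z => exact absurd ⟨z, hx⟩ hu
      obtain ⟨x, hx, y, hy, hne⟩ := hS
      obtain ⟨x, rfl⟩ := hdown x hx
      obtain ⟨y, rfl⟩ := hdown y hy
      obtain ⟨p, h₁, h₂⟩ := ihd {z | Leaf.down z ∈ S} ⟨x, hx, y, hy, fun h => hne (h ▸ rfl)⟩
      refine ⟨Vertex.down p, fun z hz => ?_, fun i => ?_⟩
      · obtain ⟨z, rfl⟩ := hdown z hz
        exact (h₁ z hz).imp fun _ h => .down h
      · obtain ⟨z, hz, h⟩ := h₂ i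
        exact ⟨_, hz, .down h⟩

/-- The clusters of a plane binary tree, on a set `X` that labels its leaves. -/
def hierarchy {X : Type*} (t : PlaneBinaryTree) (f : X ≃ Leaf t) :
    BinaryHierarchy X (Vertex t) where
  side p i := {x | BelowChild p i (f x)}
  side_unique h h' := h.unique h'
  nested h h' := (h.nested h').imp_right
    (Or.imp (fun H k _ hy => H k _ hy) fun H k _ hy => H k _ hy)
  exists_split S hS := by
    obtain ⟨p, h₁, h₂⟩ := exists_belowChild_split (f '' S) (hS.image f.injective)
    refine ⟨p, fun x hx => h₁ _ ⟨x, hx, rfl⟩, fun i => ?_⟩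
    obtain ⟨_, ⟨x, hx, rfl⟩, h⟩ := h₂ i
    exact ⟨x, hx, h⟩

/-- `Switches s t f`: a finite sequence of switches turns `s` into `t`, moving the leaves
according to `f`. -/
inductive Switches (s : PlaneBinaryTree) : (t : PlaneBinaryTree) → (Leaf s ≃ Leaf t) → Prop
  | refl : Switches s s (Equiv.refl _)
  | tail {t t' : PlaneBinaryTree} {f : Leaf s ≃ Leaf t} (h : Switches s t f) (w : Switch t t') :
      Switches s t' (f.trans w.leafEquiv)

theorem Switches.trans {s t r : PlaneBinaryTree} {f : Leaf s ≃ Leaf t} {g : Leaf t ≃ Leaf r}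
    (h : Switches s t f) (h' : Switches t r g) : Switches s r (f.trans g) := by
  induction h' with
  | refl => exact h
  | tail _ w ih => exact ih.tail w

/-- Bijections between the leaves of the two pairs of subtrees combine. -/
def leafCongr {u u' d d' : PlaneBinaryTree} (f : Leaf u ≃ Leaf u') (g : Leaf d ≃ Leaf d') :
    Leaf (node u d) ≃ Leaf (node u' d') where
  toFun
    | Leaf.up x => Leaf.up (f x)
    | Leaf.down x => Leaf.down (g x)
  invFun
    | Leaf.up x => Leaf.up (f.symm x)
    | Leaf.down x => Leaf.down (g.symm x)
  left_inv x := by cases x <;> simp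
  right_inv x := by cases x <;> simp

theorem Switches.up {u u' : PlaneBinaryTree} {f : Leaf u ≃ Leaf u'} (h : Switches u u' f)
    (d : PlaneBinaryTree) : Switches (node u d) (node u' d) (leafCongr f (Equiv.refl _)) := by
  induction h with
  | refl =>
    convert Switches.refl
    ext x
    cases x <;> rfl
  | tail _ w ih =>
    convert ih.tail (Switch.up w d) using 1
    ext x
    cases x <;> rfl

theorem Switches.down {d d' : PlaneBinaryTree} {f : Leaf d ≃ Leaf d'} (u : PlaneBinaryTree)
    (h : Switches d d' f) : Switches (node u d) (node u d') (leafCongr (Equiv.refl _) f) := by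
  induction h with
  | refl =>
    convert Switches.refl
    ext x
    cases x <;> rfl
  | tail _ w ih =>
    convert ih.tail (Switch.down u w) using 1
    ext x
    cases x <;> rfl

/-- Every choice of the child to be drawn above at each vertex is attained by switches. -/
theorem exists_switches (t : PlaneBinaryTree) (ε : Vertex t → Bool) :
    ∃ (t' : PlaneBinaryTree) (f : Leaf t ≃ Leaf t'), Switches t t' f ∧
      ∀ x y, Above (f x) (f y) → ∃ p, BelowChild p (ε p) x ∧ BelowChild p (!ε p) y := by
  induction t with
  | leaf => exact ⟨leaf, Equiv.refl _, .refl, fun x y h => by cases x; cases y; cases h⟩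
  | node u d ihu ihd =>
    obtain ⟨u', f, hf, hu⟩ := ihu fun v => ε v.up
    obtain ⟨d', g, hg, hd⟩ := ihd fun v => ε v.down
    have hs : Switches (node u d) (node u' d') (leafCongr f g) := by
      convert (hf.up d).trans (hg.down u') using 1
      ext x
      cases x <;> rfl
    cases hε : ε Vertex.root
    · refine ⟨_, _, hs, fun x y h => ?_⟩
      cases x with
      | up x =>
        cases y with
        | up y =>
          cases h with | up h =>
          obtain ⟨p, h₁, h₂⟩ := hu x y h
          exact ⟨p.up, .up h₁, .up h₂⟩
        | down y => exact ⟨Vertex.root, hε ▸ .upper x, hε ▸ .lower y⟩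
      | down x =>
        cases y with
        | up y => cases h
        | down y =>
          cases h with | down h =>
          obtain ⟨p, h₁, h₂⟩ := hd x y h
          exact ⟨p.down, .down h₁, .down h₂⟩
    -- Here the lower child of the root is to be drawn above: one more switch at the root, which
    -- exchanges the two constructors in `h`.
    · refine ⟨_, _, hs.tail (Switch.here u' d'), fun x y h => ?_⟩
      cases x with
      | up x =>
        cases y with
        | up y =>
          cases h with | down h =>
          obtain ⟨p, h₁, h₂⟩ := hu x y h
          exact ⟨p.up, .up h₁, .up h₂⟩
        | down y => cases h
      | down x =>
        cases y with
        | up y => exact ⟨Vertex.root, hε ▸ .lower x, hε ▸ .upper y⟩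
        | down y =>
          cases h with | up h =>
          obtain ⟨p, h₁, h₂⟩ := hd x y h
          exact ⟨p.down, .down h₁, .down h₂⟩

end PlaneBinaryTree

/-! ### From consistent orientations to crossing-free layouts -/

namespace TanglegramLayout

open PlaneBinaryTree

theorem reflTransGen_switchStep_left {L L' R : PlaneBinaryTree} (σ : Leaf L ≃ Leaf R)
    {f : Leaf L ≃ Leaf L'} (h : Switches L L' f) :
    Relation.ReflTransGen SwitchStep ⟨L, R, σ⟩ ⟨L', R, f.symm.trans σ⟩ := by
  induction h with
  | refl => exact .refl
  | tail _ w ih => exact ih.tail (SwitchStep.left _ w)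

theorem reflTransGen_switchStep_right {L R R' : PlaneBinaryTree} (σ : Leaf L ≃ Leaf R)
    {f : Leaf R ≃ Leaf R'} (h : Switches R R' f) :
    Relation.ReflTransGen SwitchStep ⟨L, R, σ⟩ ⟨L, R', σ.trans f⟩ := by
  induction h with
  | refl => exact .refl
  | tail _ w ih => exact ih.tail (SwitchStep.right _ w)

/-- A layout of a non-planar tanglegram contains one of the two minimal conflicts. -/
theorem exists_conflict (Λ : TanglegramLayout)
    (h : ¬ Tanglegram.IsPlanar (Quotient.mk switchSetoid Λ)) :
    (hierarchy Λ.L (Equiv.refl _)).BalancedConflict (hierarchy Λ.R Λ.σ) ∨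
      (hierarchy Λ.L (Equiv.refl _)).CaterpillarConflict (hierarchy Λ.R Λ.σ) := by
  by_contra hcon
  obtain ⟨hB, hC⟩ := not_or.1 hcon
  obtain ⟨ε, δ, hεδ⟩ := BinaryHierarchy.exists_orientation hB hC
  obtain ⟨L, R, σ⟩ := Λ
  obtain ⟨L', f, hf, hL⟩ := exists_switches L ε
  obtain ⟨R', g, hg, hR⟩ := exists_switches R δ
  refine h ⟨⟨L', R', (f.symm.trans σ).trans g⟩, Quotient.sound (switchSetoid.symm
    ((reflTransGen_switchStep_left σ hf).trans (reflTransGen_switchStep_right _ hg))), ?_⟩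
  rintro x y ⟨h₁, h₂⟩
  obtain ⟨p, hx, hy⟩ := hL (f.symm x) (f.symm y) (by simpa using h₁)
  obtain ⟨q, hy', hx'⟩ := hR (σ (f.symm y)) (σ (f.symm x)) h₂
  -- A crossing pairs the side of `p` drawn above with the side of `q` drawn below, so its parity is
  -- opposite to the one that the orientation satisfies.
  have := hεδ p q _ ⟨ε p, !δ q, f.symm x, f.symm y, hx, hy, hx',
    by rw [Bool.not_not]; exact hy', rfl⟩
  revert this
  cases ε p <;> cases δ q <;> simp

end TanglegramLayout

/-! ### Tree order, paths and five-ended caterpillars -/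

theorem SimpleGraph.Walk.IsPath.exists_map {V W : Type*} {G : SimpleGraph V} {G' : SimpleGraph W}
    {a b : V} {P : G.Walk a b} (hP : P.IsPath) (f : G →g G') (hf : Function.Injective f) :
    ∃ Q : G'.Walk (f a) (f b), Q.IsPath ∧ ∀ x ∈ Q.support, ∃ y ∈ P.support, f y = x :=
  ⟨P.map f, hP.map hf, fun x hx => by
    rwa [SimpleGraph.Walk.support_map, List.mem_map] at hx⟩

namespace PlaneBinaryTree

/-- `Ancestor v w`: the vertex `v` lies on the path from the root to `w`. -/
inductive Ancestor : {t : PlaneBinaryTree} → Vertex t → Vertex t → Prop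
  | root {t : PlaneBinaryTree} (v : Vertex t) : Ancestor Vertex.root v
  | up {u d : PlaneBinaryTree} {v w : Vertex u} (h : Ancestor v w) :
      Ancestor (Vertex.up v : Vertex (node u d)) (Vertex.up w)
  | down {u d : PlaneBinaryTree} {v w : Vertex d} (h : Ancestor v w) :
      Ancestor (Vertex.down v : Vertex (node u d)) (Vertex.down w)

/-- The tree order, with the root as least element. -/
instance (t : PlaneBinaryTree) : PartialOrder (Vertex t) where
  le := Ancestor
  le_refl v := by
    induction v with
    | root => exact .root _
    | up v ih => exact .up ih
    | down v ih => exact .down ih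
  le_trans v w x h h' := by
    induction h with
    | root => exact .root _
    | up h ih => cases h' with | up h' => exact .up (ih _ h')
    | down h ih => cases h' with | down h' => exact .down (ih _ h')
  le_antisymm v w h h' := by
    induction h with
    | root => cases h'; rfl
    | up h ih => cases h' with | up h' => rw [ih h']
    | down h ih => cases h' with | down h' => rw [ih h']

theorem root_le {t : PlaneBinaryTree} (v : Vertex t) : Vertex.root ≤ v := Ancestor.root v

/-- A plane binary tree as a graph. -/
def treeGraph (t : PlaneBinaryTree) : SimpleGraph (Vertex t) := SimpleGraph.fromRel IsChild

/-- The upper subtree as a subgraph. -/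
def treeGraphUp (u d : PlaneBinaryTree) : treeGraph u →g treeGraph (node u d) where
  toFun := Vertex.up
  map_rel' {a b} h := by
    rw [treeGraph, SimpleGraph.fromRel_adj] at h ⊢
    exact ⟨fun e => h.1 (Vertex.up.inj e), h.2.imp .up .up⟩

/-- The lower subtree as a subgraph. -/
def treeGraphDown (u d : PlaneBinaryTree) : treeGraph d →g treeGraph (node u d) where
  toFun := Vertex.down
  map_rel' {a b} h := by
    rw [treeGraph, SimpleGraph.fromRel_adj] at h ⊢
    exact ⟨fun e => h.1 (Vertex.down.inj e), h.2.imp .down .down⟩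

theorem exists_path_of_le {t : PlaneBinaryTree} {v w : Vertex t} (h : v ≤ w) :
    ∃ P : (treeGraph t).Walk v w, P.IsPath ∧ ∀ x ∈ P.support, v ≤ x ∧ x ≤ w := by
  induction h with
  | root w =>
    induction w with
    | root => exact ⟨.nil, .nil, by simp [root_le]⟩
    | @up u d w ih =>
      obtain ⟨P, hP, hs⟩ := ih
      obtain ⟨Q, hQ, hQs⟩ : ∃ Q : (treeGraph (node u d)).Walk (Vertex.up Vertex.root) (Vertex.up w),
          Q.IsPath ∧ ∀ x ∈ Q.support, ∃ y ∈ P.support, Vertex.up y = x :=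
        hP.exists_map (treeGraphUp u d) fun _ _ => Vertex.up.inj
      have hadj : (treeGraph (node u d)).Adj Vertex.root (Vertex.up Vertex.root) :=
        (SimpleGraph.fromRel_adj _ _ _).2 ⟨nofun, Or.inl .upper⟩
      refine ⟨.cons hadj Q, hQ.cons fun h => ?_, fun x hx => ⟨root_le x, ?_⟩⟩
      · obtain ⟨_, -, h⟩ := hQs _ h
        cases h
      · rw [SimpleGraph.Walk.support_cons, List.mem_cons] at hx
        obtain rfl | hx := hx
        · exact root_le _
        · obtain ⟨y, hy, rfl⟩ := hQs _ hx
          exact .up (hs y hy).2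
    | @down u d w ih =>
      obtain ⟨P, hP, hs⟩ := ih
      obtain ⟨Q, hQ, hQs⟩ :
          ∃ Q : (treeGraph (node u d)).Walk (Vertex.down Vertex.root) (Vertex.down w),
          Q.IsPath ∧ ∀ x ∈ Q.support, ∃ y ∈ P.support, Vertex.down y = x :=
        hP.exists_map (treeGraphDown u d) fun _ _ => Vertex.down.inj
      have hadj : (treeGraph (node u d)).Adj Vertex.root (Vertex.down Vertex.root) :=
        (SimpleGraph.fromRel_adj _ _ _).2 ⟨nofun, Or.inl .lower⟩
      refine ⟨.cons hadj Q, hQ.cons fun h => ?_, fun x hx => ⟨root_le x, ?_⟩⟩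
      · obtain ⟨_, -, h⟩ := hQs _ h
        cases h
      · rw [SimpleGraph.Walk.support_cons, List.mem_cons] at hx
        obtain rfl | hx := hx
        · exact root_le _
        · obtain ⟨y, hy, rfl⟩ := hQs _ hx
          exact .down (hs y hy).2
  | @up u d v w h ih =>
    obtain ⟨P, hP, hs⟩ := ih
    obtain ⟨Q, hQ, hQs⟩ := hP.exists_map (treeGraphUp u d) fun _ _ => Vertex.up.inj
    refine ⟨Q, hQ, fun x hx => ?_⟩
    obtain ⟨y, hy, rfl⟩ := hQs x hx
    exact ⟨.up (hs y hy).1, .up (hs y hy).2⟩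
  | @down u d v w h ih =>
    obtain ⟨P, hP, hs⟩ := ih
    obtain ⟨Q, hQ, hQs⟩ := hP.exists_map (treeGraphDown u d) fun _ _ => Vertex.down.inj
    refine ⟨Q, hQ, fun x hx => ?_⟩
    obtain ⟨y, hy, rfl⟩ := hQs x hx
    exact ⟨.down (hs y hy).1, .down (hs y hy).2⟩

theorem exists_path_of_ge {t : PlaneBinaryTree} {v w : Vertex t} (h : v ≤ w) :
    ∃ P : (treeGraph t).Walk w v, P.IsPath ∧ ∀ x ∈ P.support, v ≤ x ∧ x ≤ w := by
  obtain ⟨P, hP, hs⟩ := exists_path_of_le h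
  exact ⟨P.reverse, hP.reverse, fun x hx => hs x (by simpa using hx)⟩

theorem BelowChild.le {t : PlaneBinaryTree} {p : Vertex t} {i : Bool} {x : Leaf t}
    (h : BelowChild p i x) : p ≤ x.toVertex := by
  induction h with
  | upper | lower => exact root_le _
  | up _ ih => exact .up ih
  | down _ ih => exact .down ih

/-- `IsMeet p x y`: the vertex `p` is the last common ancestor of `x` and `y`. -/
def IsMeet {t : PlaneBinaryTree} (p x y : Vertex t) : Prop := ∀ v, v ≤ p ↔ v ≤ x ∧ v ≤ y

theorem IsMeet.symm {t : PlaneBinaryTree} {p x y : Vertex t} (h : IsMeet p x y) :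
    IsMeet p y x := fun v => (h v).trans and_comm

theorem BelowChild.isMeet {t : PlaneBinaryTree} {p : Vertex t} {i : Bool} {x y : Leaf t}
    (hx : BelowChild p i x) (hy : BelowChild p (!i) y) : IsMeet p x.toVertex y.toVertex := by
  refine fun v => ⟨fun h => ⟨h.trans hx.le, h.trans hy.le⟩, fun ⟨h₁, h₂⟩ => ?_⟩
  induction hx with
  | upper x =>
    cases hy
    cases h₁ with
    | root => exact root_le _
    | up => cases h₂
  | lower x =>
    cases hy
    cases h₁ with
    | root => exact root_le _
    | down => cases h₂
  | up _ ih =>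
    cases hy with | up hy =>
    cases h₁ with
    | root => exact root_le _
    | up h₁ => cases h₂ with | up h₂ => exact .up (ih hy _ ⟨h₁, h₂⟩ h₁ h₂)
  | down _ ih =>
    cases hy with | down hy =>
    cases h₁ with
    | root => exact root_le _
    | down h₁ => cases h₂ with | down h₂ => exact .down (ih hy _ ⟨h₁, h₂⟩ h₁ h₂)

/-- Supplies the outer branch vertices of the caterpillars. The vertex that splits the pair is a
common ancestor at or below `p`, and it differs from `p`, which does not separate the pair. -/
theorem BelowChild.exists_isMeet {t : PlaneBinaryTree} {p : Vertex t} {i : Bool} {x y : Leaf t}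
    (hx : BelowChild p i x) (hy : BelowChild p i y) (hne : x ≠ y) :
    ∃ a, p < a ∧ IsMeet a x.toVertex y.toVertex := by
  obtain ⟨a, h₁, h₂⟩ := exists_belowChild_split {x, y} ⟨x, by simp, y, by simp, hne⟩
  obtain ⟨k, hk⟩ := h₁ x (by simp)
  obtain ⟨z, hz, hzk⟩ := h₂ !k
  obtain rfl | rfl := hz
  · exact absurd (hk.unique hzk) (by simp)
  · refine ⟨a, lt_of_le_of_ne ((hk.isMeet hzk p).2 ⟨hx.le, hy.le⟩) ?_, hk.isMeet hzk⟩
    rintro rfl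
    exact absurd ((hk.unique hx).trans (hy.unique hzk)) (by simp)

theorem lt_of_belowChild_imp {t : PlaneBinaryTree} {p p₀ : Vertex t} {i i₀ : Bool} {x y : Leaf t}
    (h : ∀ k z, BelowChild p k z → BelowChild p₀ i₀ z) (hx : BelowChild p i x)
    (hy : BelowChild p (!i) y) : p₀ < p := by
  refine lt_of_le_of_ne ((hx.isMeet hy p₀).2 ⟨(h _ _ hx).le, (h _ _ hy).le⟩) ?_
  rintro rfl
  exact absurd (((h _ _ hx).unique hx).symm.trans ((h _ _ hy).unique hy)) (by simp)

/-- The branch vertex of a caterpillar with five leaves to which each leaf is attached. -/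
def attach : Fin 5 → Fin 3 := ![0, 1, 1, 2, 2]

/-- `IsCaterpillar G port branch col`: the graph `G` contains a subdivision of the cubic tree with
five leaves in which `branch 0` is the middle one of the three vertices of degree three, the
leaves being `port k`. The coloring `col` separates the interiors of the paths. -/
structure IsCaterpillar {V : Type*} (G : SimpleGraph V) (port : Fin 5 → V) (branch : Fin 3 → V)
    (col : V → Fin 2 ⊕ Fin 5) : Prop where
  injective : Function.Injective branch
  inner (i : Fin 2) : ∃ P : G.Walk (branch 0) (branch i.succ), P.IsPath ∧ ∀ v ∈ P.support,
    v = branch 0 ∨ v = branch i.succ ∨ col v = Sum.inl i ∧ ∀ j, v ≠ branch j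
  leg (k : Fin 5) : ∃ P : G.Walk (branch (attach k)) (port k), P.IsPath ∧ ∀ v ∈ P.support,
    v = branch (attach k) ∨ col v = Sum.inr k ∧ ∀ j, v ≠ branch j

/-- The middle branch vertex is `p`, with the path to the root as its leg; `a` and `b` carry the two
pairs of leaves. -/
theorem exists_isCaterpillar_of_balanced {t : PlaneBinaryTree} {p a b x₁ x₂ x₃ x₄ : Vertex t}
    (ha : IsMeet a x₁ x₂) (hb : IsMeet b x₃ x₄) (h₁₃ : IsMeet p x₁ x₃) (h₁₄ : IsMeet p x₁ x₄)
    (h₂₃ : IsMeet p x₂ x₃) (h₂₄ : IsMeet p x₂ x₄) (hpa : p < a) (hpb : p < b) :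
    ∃ branch col, IsCaterpillar (treeGraph t) ![Vertex.root, x₁, x₂, x₃, x₄] branch col := by
  classical
  have hap : ¬ a ≤ p := hpa.not_ge
  have hbp : ¬ b ≤ p := hpb.not_ge
  have hax : a ≤ x₁ ∧ a ≤ x₂ := (ha a).1 le_rfl
  have hbx : b ≤ x₃ ∧ b ≤ x₄ := (hb b).1 le_rfl
  have hab : ¬ a ≤ b := fun h => hap ((h₁₃ a).2 ⟨hax.1, h.trans hbx.1⟩)
  have hba : ¬ b ≤ a := fun h => hbp ((h₁₃ b).2 ⟨h.trans hax.1, hbx.1⟩)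
  have branch_ne {v : Vertex t} (h₀ : v ≠ p) (h₁ : v ≠ a) (h₂ : v ≠ b) (j : Fin 3) :
      v ≠ (![p, a, b] : Fin 3 → Vertex t) j := by fin_cases j <;> assumption
  -- A vertex is colored by the first vertex in this list that it precedes in the tree order. A
  -- vertex shared by two branches precedes their meet, which is listed earlier or is their common
  -- starting point, so the interiors get the intended colors.
  refine ⟨![p, a, b], fun v =>
    if v ≤ p then Sum.inr 0 else if v ≤ a then Sum.inl 0 else if v ≤ b then Sum.inl 1 else
    if v ≤ x₁ then Sum.inr 1 else if v ≤ x₂ then Sum.inr 2 else if v ≤ x₃ then Sum.inr 3 else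
    Sum.inr 4, ?_, fun i => ?_, fun k => ?_⟩
  · intro i j
    fin_cases i <;> fin_cases j <;> simp [hpa.ne, hpa.ne', hpb.ne, hpb.ne'] <;> grind
  · fin_cases i
    · obtain ⟨P, hP, hs⟩ := exists_path_of_le hpa.le
      refine ⟨P, hP, fun v hv => ?_⟩
      obtain ⟨h₁, h₂⟩ := hs v hv
      by_cases hvp : v = p
      · exact Or.inl hvp
      by_cases hva : v = a
      · exact Or.inr (Or.inl hva)
      have n₁ : ¬ v ≤ p := fun h => hvp (le_antisymm h h₁)
      exact Or.inr (Or.inr ⟨by simp [n₁, h₂], branch_ne hvp hva fun h => hba (h ▸ h₂)⟩)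
    · obtain ⟨P, hP, hs⟩ := exists_path_of_le hpb.le
      refine ⟨P, hP, fun v hv => ?_⟩
      obtain ⟨h₁, h₂⟩ := hs v hv
      by_cases hvp : v = p
      · exact Or.inl hvp
      by_cases hvb : v = b
      · exact Or.inr (Or.inl hvb)
      have n₁ : ¬ v ≤ p := fun h => hvp (le_antisymm h h₁)
      have n₂ : ¬ v ≤ a := fun h => n₁ ((h₁₃ v).2 ⟨h.trans hax.1, h₂.trans hbx.1⟩)
      exact Or.inr (Or.inr ⟨by simp [n₁, n₂, h₂], branch_ne hvp (fun h => hab (h ▸ h₂)) hvb⟩)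
  · fin_cases k
    · obtain ⟨P, hP, hs⟩ := exists_path_of_ge (root_le p)
      refine ⟨P, hP, fun v hv => ?_⟩
      obtain ⟨-, h⟩ := hs v hv
      by_cases hvp : v = p
      · exact Or.inl hvp
      exact Or.inr ⟨by simp [h], branch_ne hvp (fun e => hap (e ▸ h)) fun e => hbp (e ▸ h)⟩
    · obtain ⟨P, hP, hs⟩ := exists_path_of_le hax.1
      refine ⟨P, hP, fun v hv => ?_⟩
      obtain ⟨h₁, h₂⟩ := hs v hv
      by_cases hva : v = a
      · exact Or.inl hva
      have n₁ : ¬ v ≤ a := fun h => hva (le_antisymm h h₁)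
      have n₂ : ¬ v ≤ p := fun h => n₁ (h.trans hpa.le)
      have n₃ : ¬ v ≤ b := fun h => n₂ ((h₁₃ v).2 ⟨h₂, h.trans hbx.1⟩)
      exact Or.inr ⟨by simp [n₁, n₂, n₃, h₂],
        branch_ne (fun e => n₂ e.le) hva fun e => n₃ e.le⟩
    · obtain ⟨P, hP, hs⟩ := exists_path_of_le hax.2
      refine ⟨P, hP, fun v hv => ?_⟩
      obtain ⟨h₁, h₂⟩ := hs v hv
      by_cases hva : v = a
      · exact Or.inl hva
      have n₁ : ¬ v ≤ a := fun h => hva (le_antisymm h h₁)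
      have n₂ : ¬ v ≤ p := fun h => n₁ (h.trans hpa.le)
      have n₃ : ¬ v ≤ b := fun h => n₂ ((h₂₃ v).2 ⟨h₂, h.trans hbx.1⟩)
      have n₄ : ¬ v ≤ x₁ := fun h => n₁ ((ha v).2 ⟨h, h₂⟩)
      exact Or.inr ⟨by simp [n₁, n₂, n₃, n₄, h₂],
        branch_ne (fun e => n₂ e.le) hva fun e => n₃ e.le⟩
    · obtain ⟨P, hP, hs⟩ := exists_path_of_le hbx.1
      refine ⟨P, hP, fun v hv => ?_⟩
      obtain ⟨h₁, h₂⟩ := hs v hv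
      by_cases hvb : v = b
      · exact Or.inl hvb
      have n₁ : ¬ v ≤ b := fun h => hvb (le_antisymm h h₁)
      have n₂ : ¬ v ≤ p := fun h => n₁ (h.trans hpb.le)
      have n₃ : ¬ v ≤ x₁ := fun h => n₂ ((h₁₃ v).2 ⟨h, h₂⟩)
      have n₄ : ¬ v ≤ x₂ := fun h => n₂ ((h₂₃ v).2 ⟨h, h₂⟩)
      have n₅ : ¬ v ≤ a := fun h => n₃ (h.trans hax.1)
      exact Or.inr ⟨by simp [n₁, n₂, n₃, n₄, n₅, h₂],
        branch_ne (fun e => n₂ e.le) (fun e => n₅ e.le) hvb⟩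
    · obtain ⟨P, hP, hs⟩ := exists_path_of_le hbx.2
      refine ⟨P, hP, fun v hv => ?_⟩
      obtain ⟨h₁, h₂⟩ := hs v hv
      by_cases hvb : v = b
      · exact Or.inl hvb
      have n₁ : ¬ v ≤ b := fun h => hvb (le_antisymm h h₁)
      have n₂ : ¬ v ≤ p := fun h => n₁ (h.trans hpb.le)
      have n₃ : ¬ v ≤ x₁ := fun h => n₂ ((h₁₄ v).2 ⟨h, h₂⟩)
      have n₄ : ¬ v ≤ x₂ := fun h => n₂ ((h₂₄ v).2 ⟨h, h₂⟩)
      have n₅ : ¬ v ≤ a := fun h => n₃ (h.trans hax.1)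
      have n₆ : ¬ v ≤ x₃ := fun h => n₁ ((hb v).2 ⟨h, h₂⟩)
      exact Or.inr ⟨by simp [n₁, n₂, n₃, n₄, n₅, n₆],
        branch_ne (fun e => n₂ e.le) (fun e => n₅ e.le) hvb⟩

/-- Now the root is attached to an outer branch vertex `r`, together with `x₂`; the middle one is
`c`, which carries `x₀`. The coloring follows the same principle as in the balanced case. -/
theorem exists_isCaterpillar_of_comb {t : PlaneBinaryTree} {r c e x₀ x₂ x₃ x₄ : Vertex t}
    (he : IsMeet e x₃ x₄) (h₀₃ : IsMeet c x₀ x₃) (h₀₄ : IsMeet c x₀ x₄) (h₂₀ : IsMeet r x₂ x₀)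
    (h₂₃ : IsMeet r x₂ x₃) (h₂₄ : IsMeet r x₂ x₄) (hrc : r < c) (hce : c < e) :
    ∃ branch col, IsCaterpillar (treeGraph t) ![x₀, Vertex.root, x₂, x₃, x₄] branch col := by
  classical
  have hcr : ¬ c ≤ r := hrc.not_ge
  have hec : ¬ e ≤ c := hce.not_ge
  have her : ¬ e ≤ r := (hrc.trans hce).not_ge
  have hcx : c ≤ x₀ ∧ c ≤ x₃ := (h₀₃ c).1 le_rfl
  have hrx : r ≤ x₂ ∧ r ≤ x₃ := (h₂₃ r).1 le_rfl
  have hex : e ≤ x₃ ∧ e ≤ x₄ := (he e).1 le_rfl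
  have branch_ne {v : Vertex t} (h₀ : v ≠ c) (h₁ : v ≠ r) (h₂ : v ≠ e) (j : Fin 3) :
      v ≠ (![c, r, e] : Fin 3 → Vertex t) j := by fin_cases j <;> assumption
  refine ⟨![c, r, e], fun v =>
    if v ≤ r then Sum.inr 1 else if v ≤ c then Sum.inl 0 else if v ≤ e then Sum.inl 1 else
    if v ≤ x₀ then Sum.inr 0 else if v ≤ x₂ then Sum.inr 2 else if v ≤ x₃ then Sum.inr 3 else
    Sum.inr 4, ?_, fun i => ?_, fun k => ?_⟩
  · intro i j
    fin_cases i <;> fin_cases j <;> simp [hrc.ne, hrc.ne', hce.ne, hce.ne', (hrc.trans hce).ne,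
      (hrc.trans hce).ne']
  · fin_cases i
    · obtain ⟨P, hP, hs⟩ := exists_path_of_ge hrc.le
      refine ⟨P, hP, fun v hv => ?_⟩
      obtain ⟨h₁, h₂⟩ := hs v hv
      by_cases hvc : v = c
      · exact Or.inl hvc
      by_cases hvr : v = r
      · exact Or.inr (Or.inl hvr)
      have n₁ : ¬ v ≤ r := fun h => hvr (le_antisymm h h₁)
      exact Or.inr (Or.inr ⟨by simp [n₁, h₂], branch_ne hvc hvr fun h => hec (h ▸ h₂)⟩)
    · obtain ⟨P, hP, hs⟩ := exists_path_of_le hce.le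
      refine ⟨P, hP, fun v hv => ?_⟩
      obtain ⟨h₁, h₂⟩ := hs v hv
      by_cases hvc : v = c
      · exact Or.inl hvc
      by_cases hve : v = e
      · exact Or.inr (Or.inl hve)
      have n₁ : ¬ v ≤ c := fun h => hvc (le_antisymm h h₁)
      have n₂ : ¬ v ≤ r := fun h => n₁ (h.trans hrc.le)
      exact Or.inr (Or.inr ⟨by simp [n₁, n₂, h₂], branch_ne hvc (fun h => n₂ h.le) hve⟩)
  · fin_cases k
    · obtain ⟨P, hP, hs⟩ := exists_path_of_le hcx.1
      refine ⟨P, hP, fun v hv => ?_⟩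
      obtain ⟨h₁, h₂⟩ := hs v hv
      by_cases hvc : v = c
      · exact Or.inl hvc
      have n₁ : ¬ v ≤ c := fun h => hvc (le_antisymm h h₁)
      have n₂ : ¬ v ≤ r := fun h => n₁ (h.trans hrc.le)
      have n₃ : ¬ v ≤ e := fun h => n₁ ((h₀₃ v).2 ⟨h₂, h.trans hex.1⟩)
      exact Or.inr ⟨by simp [n₁, n₂, n₃, h₂],
        branch_ne hvc (fun e => n₂ e.le) fun e => n₃ e.le⟩
    · obtain ⟨P, hP, hs⟩ := exists_path_of_ge (root_le r)
      refine ⟨P, hP, fun v hv => ?_⟩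
      obtain ⟨-, h⟩ := hs v hv
      by_cases hvr : v = r
      · exact Or.inl hvr
      exact Or.inr ⟨by simp [h], branch_ne (fun e => hcr (e ▸ h)) hvr fun e => her (e ▸ h)⟩
    · obtain ⟨P, hP, hs⟩ := exists_path_of_le hrx.1
      refine ⟨P, hP, fun v hv => ?_⟩
      obtain ⟨h₁, h₂⟩ := hs v hv
      by_cases hvr : v = r
      · exact Or.inl hvr
      have n₁ : ¬ v ≤ r := fun h => hvr (le_antisymm h h₁)
      have n₂ : ¬ v ≤ x₀ := fun h => n₁ ((h₂₀ v).2 ⟨h₂, h⟩)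
      have n₃ : ¬ v ≤ x₃ := fun h => n₁ ((h₂₃ v).2 ⟨h₂, h⟩)
      have n₄ : ¬ v ≤ c := fun h => n₂ (h.trans hcx.1)
      have n₅ : ¬ v ≤ e := fun h => n₃ (h.trans hex.1)
      exact Or.inr ⟨by simp [n₁, n₂, n₄, n₅, h₂],
        branch_ne (fun e => n₄ e.le) hvr fun e => n₅ e.le⟩
    · obtain ⟨P, hP, hs⟩ := exists_path_of_le hex.1
      refine ⟨P, hP, fun v hv => ?_⟩
      obtain ⟨h₁, h₂⟩ := hs v hv
      by_cases hve : v = e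
      · exact Or.inl hve
      have n₁ : ¬ v ≤ e := fun h => hve (le_antisymm h h₁)
      have n₂ : ¬ v ≤ c := fun h => n₁ (h.trans hce.le)
      have n₃ : ¬ v ≤ r := fun h => n₂ (h.trans hrc.le)
      have n₄ : ¬ v ≤ x₀ := fun h => n₂ ((h₀₃ v).2 ⟨h, h₂⟩)
      have n₅ : ¬ v ≤ x₂ := fun h => n₃ ((h₂₃ v).2 ⟨h, h₂⟩)
      exact Or.inr ⟨by simp [n₁, n₂, n₃, n₄, n₅, h₂],
        branch_ne (fun e => n₂ e.le) (fun e => n₃ e.le) hve⟩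
    · obtain ⟨P, hP, hs⟩ := exists_path_of_le hex.2
      refine ⟨P, hP, fun v hv => ?_⟩
      obtain ⟨h₁, h₂⟩ := hs v hv
      by_cases hve : v = e
      · exact Or.inl hve
      have n₁ : ¬ v ≤ e := fun h => hve (le_antisymm h h₁)
      have n₂ : ¬ v ≤ c := fun h => n₁ (h.trans hce.le)
      have n₃ : ¬ v ≤ r := fun h => n₂ (h.trans hrc.le)
      have n₄ : ¬ v ≤ x₀ := fun h => n₂ ((h₀₄ v).2 ⟨h, h₂⟩)
      have n₅ : ¬ v ≤ x₂ := fun h => n₃ ((h₂₄ v).2 ⟨h, h₂⟩)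
      have n₆ : ¬ v ≤ x₃ := fun h => n₁ ((he v).2 ⟨h, h₂⟩)
      exact Or.inr ⟨by simp [n₁, n₂, n₃, n₄, n₅, n₆],
        branch_ne (fun e => n₂ e.le) (fun e => n₃ e.le) hve⟩

end PlaneBinaryTree

/-! ### Assembling the subdivision of `K₃,₃` -/

/-- Coloring the inner vertices by edges turns the disjointness of all pairs of paths into a
condition on each path separately. One path per edge suffices, the other orientation being its
reverse. -/
theorem ContainedSubdivision.exists_of_paths {α β V : Type*} {G : SimpleGraph V}
    (branch : α ⊕ β → V) (hinj : Function.Injective branch) (col : V → α × β)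
    (hP : ∀ i j, ∃ P : G.Walk (branch (Sum.inl i)) (branch (Sum.inr j)), P.IsPath ∧
      ∀ v ∈ P.support, v = branch (Sum.inl i) ∨ v = branch (Sum.inr j) ∨
        col v = (i, j) ∧ ∀ c, v ≠ branch c) :
    ∃ S : ContainedSubdivision (completeBipartiteGraph α β) G, S.branch = branch := by
  choose P hpath hcol using hP
  refine ⟨{
    branch := branch
    branch_injective := hinj
    path := fun {a b} h => match a, b, h with
      | Sum.inl i, Sum.inr j, _ => P i j
      | Sum.inr j, Sum.inl i, _ => (P i j).reverse
      | Sum.inl _, Sum.inl _, h => absurd h (by simp)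
      | Sum.inr _, Sum.inr _, h => absurd h (by simp)
    isPath := ?_
    path_symm := ?_
    branch_mem := ?_
    disjoint := ?_ }, rfl⟩
  · rintro (i | j) (i' | j') h
    · simp at h
    · exact hpath i j'
    · exact (hpath i' j).reverse
    · simp at h
  · rintro (i | j) (i' | j') h
    · simp at h
    · rfl
    · exact (SimpleGraph.Walk.reverse_reverse _).symm
    · simp at h
  · have key : ∀ i j c, branch c ∈ (P i j).support → c = Sum.inl i ∨ c = Sum.inr j :=
      fun i j c hc => (hcol i j _ hc).imp (@hinj _ _) fun h =>
        h.elim (@hinj _ _) fun h => absurd rfl (h.2 c)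
    rintro (i | j) (i' | j') h c hc
    · simp at h
    · exact key i j' c hc
    · exact (key i' j c (by simpa using hc)).symm
    · simp at h
  · have key : ∀ i j i' j', (i, j) ≠ (i', j') → ∀ v, v ∈ (P i j).support →
        v ∈ (P i' j').support → v ∈ Set.range branch := by
      intro i j i' j' hne v h h'
      rcases hcol i j v h with h | h | ⟨h, -⟩
      · exact ⟨_, h.symm⟩
      · exact ⟨_, h.symm⟩
      rcases hcol i' j' v h' with h' | h' | ⟨h', -⟩
      · exact ⟨_, h'.symm⟩
      · exact ⟨_, h'.symm⟩
      · exact absurd (h.symm.trans h') hne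
    rintro (a | a) (b | b) (c | c) (d | d) h h' hne v hv hv' <;>
      first | (exfalso; simp at h; done) | (exfalso; simp at h'; done) | skip
    · exact key a b c d (fun e => hne (by simp_all)) v hv hv'
    · exact key a b d c (fun e => hne (by simp_all)) v hv (by simpa using hv')
    · exact key b a c d (fun e => hne (by simp_all)) v (by simpa using hv) hv'
    · exact key b a d c (fun e => hne (by simp_all)) v (by simpa using hv) (by simpa using hv')

namespace PlaneBinaryTree

section

variable {V W : Type*} {G : SimpleGraph V} {G' : SimpleGraph W} {T : SimpleGraph (V ⊕ W)}
  {port branch : _ → V} {port' branch' : _ → W} {col : V → Fin 2 ⊕ Fin 5}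
  {col' : W → Fin 2 ⊕ Fin 5}

theorem IsCaterpillar.exists_path (h : IsCaterpillar G port branch col)
    (h' : IsCaterpillar G' port' branch' col') (f : G →g T) (hf : ∀ v, f v = Sum.inl v)
    (f' : G' →g T) (hf' : ∀ w, f' w = Sum.inr w) {k k' : Fin 5}
    (hk : T.Adj (Sum.inl (port k)) (Sum.inr (port' k'))) :
    ∃ P : T.Walk (Sum.inl (branch (attach k))) (Sum.inr (branch' (attach k'))), P.IsPath ∧
      ∀ v ∈ P.support, v = Sum.inl (branch (attach k)) ∨ v = Sum.inr (branch' (attach k')) ∨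
        (∃ x, v = Sum.inl x ∧ col x = Sum.inr k ∧ ∀ j, x ≠ branch j) ∨
        ∃ x, v = Sum.inr x ∧ col' x = Sum.inr k' ∧ ∀ j, x ≠ branch' j := by
  obtain ⟨P, hP, hs⟩ := h.leg k
  obtain ⟨P', hP', hs'⟩ := h'.leg k'
  obtain ⟨Q, hQ, hQs⟩ := hP.exists_map f fun a b e => Sum.inl_injective (by rwa [← hf, ← hf])
  obtain ⟨Q', hQ', hQs'⟩ :=
    hP'.reverse.exists_map f' fun a b e => Sum.inr_injective (by rwa [← hf', ← hf'])
  have hk' : T.Adj (f (port k)) (f' (port' k')) := by rwa [hf, hf']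
  rw [← hf, ← hf']
  refine ⟨Q.append (.cons hk' Q'), ?_, fun v hv => ?_⟩
  · rw [SimpleGraph.Walk.isPath_def, SimpleGraph.Walk.support_append,
      SimpleGraph.Walk.support_cons, List.tail_cons, List.nodup_append]
    refine ⟨hQ.support_nodup, hQ'.support_nodup, ?_⟩
    rintro x hx _ hx' rfl
    obtain ⟨y, -, rfl⟩ := hQs x hx
    obtain ⟨y', -, e⟩ := hQs' _ hx'
    rw [hf, hf'] at e
    cases e
  · rw [SimpleGraph.Walk.support_append, SimpleGraph.Walk.support_cons, List.tail_cons,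
      List.mem_append] at hv
    rcases hv with hv | hv
    · obtain ⟨x, hx, rfl⟩ := hQs v hv
      rcases hs x hx with rfl | hx
      · exact Or.inl rfl
      · exact Or.inr (Or.inr (Or.inl ⟨x, hf x, hx⟩))
    · obtain ⟨x, hx, rfl⟩ := hQs' v hv
      rcases hs' x (by simpa using hx) with rfl | hx
      · exact Or.inr (Or.inl rfl)
      · exact Or.inr (Or.inr (Or.inr ⟨x, hf' x, hx⟩))

/-- Two caterpillars joined at their ports, one with a crossing of the ports, form a subdivided
`K₃,₃`. -/
theorem IsCaterpillar.exists_containedSubdivision (h : IsCaterpillar G port branch col)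
    (h' : IsCaterpillar G' port' branch' col') (f : G →g T) (hf : ∀ v, f v = Sum.inl v)
    (f' : G' →g T) (hf' : ∀ w, f' w = Sum.inr w)
    (hk : ∀ k, T.Adj (Sum.inl (port k))
      (Sum.inr (port' ((![0, 1, 3, 2, 4] : Fin 5 → Fin 5) k)))) :
    ∃ S : ContainedSubdivision (completeBipartiteGraph (Fin 3) (Fin 3)) T,
      {w | ∃ v, S.branch w = Sum.inl v}.ncard = 3 ∧
      {w | ∃ v, S.branch w = Sum.inr v}.ncard = 3 := by
  -- The classes of `K₃,₃` are not the two trees: each middle branch vertex joins the outer two of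
  -- the other tree. The edges inside the trees then run between the classes, as do the five paths
  -- through the ports.
  let B : Fin 3 ⊕ Fin 3 → V ⊕ W := Sum.elim
    ![Sum.inl (branch 0), Sum.inr (branch' 1), Sum.inr (branch' 2)]
    ![Sum.inr (branch' 0), Sum.inl (branch 1), Sum.inl (branch 2)]
  have hB : Function.Injective B := by
    rintro (i | i) (j | j) <;> fin_cases i <;> fin_cases j <;>
      simp [B, h.injective.eq_iff, h'.injective.eq_iff]
  -- Each inner path or leg receives the edge of `K₃,₃` it belongs to. The entries for ports 2 and 3
  -- on the right are exchanged, as the matching of ports prescribes.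
  let C : V ⊕ W → Fin 3 × Fin 3 := Sum.elim
    (fun v => (col v).elim ![(0, 1), (0, 2)] ![(0, 0), (1, 1), (2, 1), (1, 2), (2, 2)])
    (fun w => (col' w).elim ![(1, 0), (2, 0)] ![(0, 0), (1, 1), (1, 2), (2, 1), (2, 2)])
  have neL {x : V} (hx : ∀ j, x ≠ branch j) : ∀ c, Sum.inl x ≠ B c := by
    rintro (c | c) <;> fin_cases c <;> simp [B, hx]
  have neR {x : W} (hx : ∀ j, x ≠ branch' j) : ∀ c, Sum.inr x ≠ B c := by
    rintro (c | c) <;> fin_cases c <;> simp [B, hx]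
  have hinj : Function.Injective f := fun a b e => Sum.inl_injective (by rwa [← hf, ← hf])
  have hinj' : Function.Injective f' := fun a b e => Sum.inr_injective (by rwa [← hf', ← hf'])
  have left (i : Fin 2) : ∃ P : T.Walk (Sum.inl (branch 0)) (Sum.inl (branch i.succ)), P.IsPath ∧
      ∀ v ∈ P.support, v = Sum.inl (branch 0) ∨ v = Sum.inl (branch i.succ) ∨
        C v = (![(0, 1), (0, 2)] : Fin 2 → Fin 3 × Fin 3) i ∧ ∀ c, v ≠ B c := by
    obtain ⟨P, hP, hs⟩ := h.inner i
    obtain ⟨Q, hQ, hQs⟩ := hP.exists_map f hinj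
    rw [← hf, ← hf]
    refine ⟨Q, hQ, fun v hv => ?_⟩
    obtain ⟨x, hx, rfl⟩ := hQs v hv
    refine (hs x hx).imp (congrArg f) (Or.imp (congrArg f) fun ⟨h₁, h₂⟩ => ?_)
    rw [hf]
    exact ⟨by simp [C, h₁], neL h₂⟩
  have right (i : Fin 2) : ∃ P : T.Walk (Sum.inr (branch' i.succ)) (Sum.inr (branch' 0)),
      P.IsPath ∧ ∀ v ∈ P.support, v = Sum.inr (branch' i.succ) ∨ v = Sum.inr (branch' 0) ∨
        C v = (![(1, 0), (2, 0)] : Fin 2 → Fin 3 × Fin 3) i ∧ ∀ c, v ≠ B c := by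
    obtain ⟨P, hP, hs⟩ := h'.inner i
    obtain ⟨Q, hQ, hQs⟩ := hP.reverse.exists_map f' hinj'
    rw [← hf', ← hf']
    refine ⟨Q, hQ, fun v hv => ?_⟩
    obtain ⟨x, hx, rfl⟩ := hQs v hv
    refine or_left_comm.1 ((hs x (by simpa using hx)).imp (congrArg f')
      (Or.imp (congrArg f') fun ⟨h₁, h₂⟩ => ?_))
    rw [hf']
    exact ⟨by simp [C, h₁], neR h₂⟩
  have mid (k : Fin 5) : ∃ P : T.Walk (Sum.inl (branch (attach k)))
      (Sum.inr (branch' (attach ((![0, 1, 3, 2, 4] : Fin 5 → Fin 5) k)))), P.IsPath ∧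
      ∀ v ∈ P.support, v = Sum.inl (branch (attach k)) ∨
        v = Sum.inr (branch' (attach ((![0, 1, 3, 2, 4] : Fin 5 → Fin 5) k))) ∨
        C v = (![(0, 0), (1, 1), (2, 1), (1, 2), (2, 2)] : Fin 5 → Fin 3 × Fin 3) k ∧
          ∀ c, v ≠ B c := by
    obtain ⟨P, hP, hs⟩ := h.exists_path h' f hf f' hf' (hk k)
    refine ⟨P, hP, fun v hv => (hs v hv).imp_right (Or.imp_right ?_)⟩
    rintro (⟨x, rfl, h₁, h₂⟩ | ⟨x, rfl, h₁, h₂⟩)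
    · exact ⟨by simp [C, h₁], neL h₂⟩
    · refine ⟨?_, neR h₂⟩
      fin_cases k <;> simp [C, h₁]
  have rev {a b : V ⊕ W} {q : Fin 3 × Fin 3} (H : ∃ P : T.Walk a b, P.IsPath ∧
      ∀ v ∈ P.support, v = a ∨ v = b ∨ C v = q ∧ ∀ c, v ≠ B c) : ∃ P : T.Walk b a, P.IsPath ∧
      ∀ v ∈ P.support, v = b ∨ v = a ∨ C v = q ∧ ∀ c, v ≠ B c := by
    obtain ⟨P, hP, hs⟩ := H
    exact ⟨P.reverse, hP.reverse, fun v hv => or_left_comm.1 (hs v (by simpa using hv))⟩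
  obtain ⟨S, hS⟩ := ContainedSubdivision.exists_of_paths (G := T) B hB C (by
    intro i j
    fin_cases i <;> fin_cases j
    · exact mid 0
    · exact left 0
    · exact left 1
    · exact right 0
    · exact rev (mid 1)
    · exact rev (mid 3)
    · exact right 1
    · exact rev (mid 2)
    · exact rev (mid 4))
  have e₁ : {w | ∃ v, S.branch w = Sum.inl v} = {Sum.inl 0, Sum.inr 1, Sum.inr 2} := by
    ext (c | c) <;> fin_cases c <;> simp [hS, B]
  have e₂ : {w | ∃ v, S.branch w = Sum.inr v} = {Sum.inr 0, Sum.inl 1, Sum.inl 2} := by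
    ext (c | c) <;> fin_cases c <;> simp [hS, B]
  refine ⟨S, ?_, ?_⟩
  · rw [e₁, Set.ncard_eq_three]
    exact ⟨_, _, _, by simp, by simp, by simp, rfl⟩
  · rw [e₂, Set.ncard_eq_three]
    exact ⟨_, _, _, by simp, by simp, by simp, rfl⟩

end

end PlaneBinaryTree

/-! ### The two conflicts inside the augmented graph -/

namespace TanglegramLayout

open PlaneBinaryTree

/-- The left tree as a subgraph of the augmented graph. -/
def leftHom (Λ : TanglegramLayout) : treeGraph Λ.L →g Λ.augmentedGraph where
  toFun := Sum.inl
  map_rel' {a b} h := Or.inl <| by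
    rw [treeGraph, SimpleGraph.fromRel_adj] at h
    exact (SimpleGraph.fromRel_adj _ _ _).2
      ⟨fun e => h.1 (Sum.inl_injective e), h.2.imp .left .left⟩

/-- The right tree as a subgraph of the augmented graph. -/
def rightHom (Λ : TanglegramLayout) : treeGraph Λ.R →g Λ.augmentedGraph where
  toFun := Sum.inr
  map_rel' {a b} h := Or.inl <| by
    rw [treeGraph, SimpleGraph.fromRel_adj] at h
    exact (SimpleGraph.fromRel_adj _ _ _).2
      ⟨fun e => h.1 (Sum.inr_injective e), h.2.imp .right .right⟩

theorem augmentedGraph_adj_matching (Λ : TanglegramLayout) (x : Leaf Λ.L) :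
    Λ.augmentedGraph.Adj (Sum.inl x.toVertex) (Sum.inr (Λ.σ x).toVertex) :=
  Or.inl ((SimpleGraph.fromRel_adj _ _ _).2 ⟨Sum.inl_ne_inr, Or.inl (.matching x)⟩)

theorem augmentedGraph_adj_root (Λ : TanglegramLayout) :
    Λ.augmentedGraph.Adj (Sum.inl Vertex.root) (Sum.inr Vertex.root) :=
  Or.inr ((SimpleGraph.edge_adj _ _ _ _).2 ⟨Or.inl ⟨rfl, rfl⟩, Sum.inl_ne_inr⟩)

/-- Both minimal conflicts yield a subdivision of `K₃,₃` in the augmented graph. -/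
theorem exists_containedSubdivision (Λ : TanglegramLayout)
    (h : ¬ Tanglegram.IsPlanar (Quotient.mk switchSetoid Λ)) :
    ∃ S : ContainedSubdivision (completeBipartiteGraph (Fin 3) (Fin 3)) Λ.augmentedGraph,
      {w | ∃ v, S.branch w = Sum.inl v}.ncard = 3 ∧
      {w | ∃ v, S.branch w = Sum.inr v}.ncard = 3 := by
  rcases Λ.exists_conflict h with ⟨p, q, i, j, u, u', v, v', hu, hu', hv, hv', ku, kv', kv, ku'⟩ |
    ⟨p₀, p, q₀, q, i₀, i, j₀, j, a, b, w, z, hp, ha, hb, hz, hw, hq, kb, ka, kz, kw⟩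
  · have ne₁ : u ≠ u' := by rintro rfl; simpa using BelowChild.unique ku ku'
    have ne₂ : v' ≠ v := by rintro rfl; simpa using BelowChild.unique kv kv'
    have ne₃ : u ≠ v' := by rintro rfl; simpa using BelowChild.unique hu hv'
    have ne₄ : u' ≠ v := by rintro rfl; simpa using BelowChild.unique hu' hv
    obtain ⟨r, hr, hr'⟩ := BelowChild.exists_isMeet hu hu' ne₁
    obtain ⟨s, hs, hs'⟩ := BelowChild.exists_isMeet hv' hv ne₂
    -- The ports are root, `u`, `u'`, `v'`, `v` on the left and root, `u`, `v'`, `u'`, `v` on the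
    -- right, so ports 2 and 3 are exchanged.
    obtain ⟨_, _, hL⟩ := exists_isCaterpillar_of_balanced hr' hs' (BelowChild.isMeet hu hv')
      (BelowChild.isMeet hu hv) (BelowChild.isMeet hu' hv') (BelowChild.isMeet hu' hv) hr hs
    obtain ⟨r, hr, hr'⟩ := BelowChild.exists_isMeet ku kv' (Λ.σ.injective.ne ne₃)
    obtain ⟨s, hs, hs'⟩ := BelowChild.exists_isMeet ku' kv (Λ.σ.injective.ne ne₄)
    obtain ⟨_, _, hR⟩ := exists_isCaterpillar_of_balanced hr' hs' (BelowChild.isMeet ku ku')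
      (BelowChild.isMeet ku kv) (BelowChild.isMeet kv' ku') (BelowChild.isMeet kv' kv) hr hs
    refine hL.exists_containedSubdivision hR Λ.leftHom (fun _ => rfl) Λ.rightHom (fun _ => rfl)
      fun k => ?_
    fin_cases k
    · exact Λ.augmentedGraph_adj_root
    all_goals exact Λ.augmentedGraph_adj_matching _
  · have ne₁ : b ≠ z := by
      rintro rfl
      simpa using BelowChild.unique kb (hq _ kz)
    have ne₂ : a ≠ z := by
      rintro rfl
      simpa using BelowChild.unique ha (hp _ hz)
    obtain ⟨r, hr, hr'⟩ := BelowChild.exists_isMeet hb hz ne₁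
    have ha' {x} {k : Bool} (hx : BelowChild p k x) :
        IsMeet p₀ (Leaf.toVertex a) x.toVertex :=
      (BelowChild.isMeet (hp k hx) ha).symm
    -- The ports are `w`, root, `a`, `b`, `z` on the left and `w`, root, `b`, `a`, `z` on the right:
    -- the same exchange, with the root edge now at port 1.
    obtain ⟨_, _, hL⟩ := exists_isCaterpillar_of_comb hr' (BelowChild.isMeet hb hw).symm
      (BelowChild.isMeet hz hw).symm (ha' hw) (ha' hb) (ha' hz)
      (lt_of_belowChild_imp (fun k x hx => hp k hx) hb hw) hr
    obtain ⟨r, hr, hr'⟩ := BelowChild.exists_isMeet ka kz (Λ.σ.injective.ne ne₂)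
    have kb' {x} {k : Bool} (hx : BelowChild q k (Λ.σ x)) :
        IsMeet q₀ (Leaf.toVertex (Λ.σ b)) (Leaf.toVertex (Λ.σ x)) :=
      (BelowChild.isMeet (hq k hx) kb).symm
    obtain ⟨_, _, hR⟩ := exists_isCaterpillar_of_comb hr' (BelowChild.isMeet ka kw).symm
      (BelowChild.isMeet kz kw).symm (kb' kw) (kb' ka) (kb' kz)
      (lt_of_belowChild_imp (fun k x hx => by
        obtain ⟨x, rfl⟩ := Λ.σ.surjective x
        exact hq k hx) ka kw) hr
    refine hL.exists_containedSubdivision hR Λ.leftHom (fun _ => rfl) Λ.rightHom (fun _ => rfl)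
      fun k => ?_
    fin_cases k
    · exact Λ.augmentedGraph_adj_matching w
    · exact Λ.augmentedGraph_adj_root
    all_goals exact Λ.augmentedGraph_adj_matching _

end TanglegramLayout

theorem corollary3 (T : Tanglegram) (hT : ¬ T.IsPlanar)
    (Λ : TanglegramLayout) (hΛ : T.IsRepresentedBy Λ) :
    ∃ S : ContainedSubdivision (completeBipartiteGraph (Fin 3) (Fin 3)) Λ.augmentedGraph,
      {w | ∃ v : PlaneBinaryTree.Vertex Λ.L, S.branch w = Sum.inl v}.ncard = 3 ∧
      {w | ∃ v : PlaneBinaryTree.Vertex Λ.R, S.branch w = Sum.inr v}.ncard = 3 := by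
  subst hΛ
  exact Λ.exists_containedSubdivision hT
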